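/- Throughout, $\log$ is the natural logarithm, $e(G)$ is the number of edges of $G$, the subgraphs of $K_n$ are the (labelled) graphs on the vertex set $\{1,\dots,n\}$, and $\mathrm{ex}(n,K_{r+1})$ is the largest number of edges in a $K_{r+1}$-free graph with $n$ vertices. For an integer $r\ge 2$ and a real number $t\ge 0$, a graph $G$ is called $t$-far from being $r$-partite if it has no $r$-partite subgraph $G'\subseteq G$ with $e(G')\ge e(G)-t$. There is an integer $n_0$ such that the following holds for all integers $n\ge n_0$ and all integers $r$ satisfying $2\le r\le \frac{\log n}{120\log\log n}$. Let $\mathcal F$ denote the family of $K_{r+1}$-free subgraphs of $K_n$ that are $(8\log n)^{-13}n^2$-far from being $r$-partite. Then \[ |\mathcal F|\le 2^{\mathrm{ex}(n,K_{r+1})-n}. \] -/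

import Mathlib

namespace SimpleGraph

/-- `G` is `t`-close to being `r`-partite: it contains an `r`-partite (that is, `r`-colourable;
parts may be empty) spanning subgraph `G'` with `e(G') ≥ e(G) - t`. -/
def CloseToPartite {V : Type*} (G : SimpleGraph V) (r : ℕ) (t : ℝ) : Prop :=
  ∃ G' : SimpleGraph V, G' ≤ G ∧ G'.Colorable r ∧
    (G.edgeSet.ncard : ℝ) - t ≤ (G'.edgeSet.ncard : ℝ)

/-- `G` is `t`-far from being `r`-partite: it is not `t`-close to being `r`-partite. -/
def FarFromPartite {V : Type*} (G : SimpleGraph V) (r : ℕ) (t : ℝ) : Prop :=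
  ¬ G.CloseToPartite r t

end SimpleGraph

/-- The family of `K_{r+1}`-free subgraphs of `K_n` (graphs with vertex set `Fin n`) that are
`t`-far from being `r`-partite. -/
def cliqueFreeFarFamily (n r : ℕ) (t : ℝ) : Set (SimpleGraph (Fin n)) :=
  {G | G.CliqueFree (r + 1) ∧ G.FarFromPartite r t}

/-! A `K_{r+1}`-free graph is an independent set in the hypergraph whose vertices are the pairs from
`Fin n` and whose edges are the copies of `K_{r+1}`. The uniformity `s = C(r+1, 2)` grows with `n`,
so it matters that `exists_container` loses only powers of `s`. It places each such graph `G`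
between a small fingerprint `S` and `S ∪ f S`, where the copies of `K_{r+1}` inside `f S` are
covered by a light family of sets of at least two pairs.

A light cover means few cliques: two or more pairs span at least three vertices and so lie in few
copies of `K_{r+1}` (`card_le_of_cover`). If `G` is `t`-far from `r`-partite, every `r`-colouring of
the graph `H` on `f S` leaves at least `t - |S|` monochromatic edges. Supersaturated stability
(`le_orderedCliques`) then yields many cliques unless `H` has at most `(1 - 1/r)n²/2 - 3t/4` edges.
Together with at most `2^(t/8)` fingerprints this gives `2^((1 - 1/r)n²/2 - 5t/8)` graphs, and
`5t/8` exceeds `n + r`, where `r` bounds the gap between `(1 - 1/r)n²/2` and the Turán number. -/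

/-! ### Hypergraph containers from an optimal measure -/

namespace HypergraphContainer

open Finset

variable {W ι : Type*} [Fintype W] [DecidableEq W] [Fintype ι]

/-- The `μ`-measure of the set of edges of the hypergraph `E` that contain `K`. -/
def weightAbove (E : ι → Finset W) (μ : ι → ℝ) (K : Finset W) : ℝ :=
  ∑ i, if K ⊆ E i then μ i else 0

/-- The nonempty sets that are disjoint from `S`. -/
def testSets (S : Finset W) : Finset (Finset W) :=
  univ.filter fun K => K.Nonempty ∧ Disjoint K S

/-- The bilinear energy of two measures on the edges, relative to the fingerprint `S`. -/
def energy (E : ι → Finset W) (a : ℝ) (S : Finset W) (μ ν : ι → ℝ) : ℝ :=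
  ∑ K ∈ testSets S, a ^ K.card * weightAbove E μ K * weightAbove E ν K

/-- The potential that `μ` induces on the edge `E i`. -/
def potential (E : ι → Finset W) (a : ℝ) (S : Finset W) (μ : ι → ℝ) (i : ι) : ℝ :=
  ∑ K ∈ (testSets S).filter (· ⊆ E i), a ^ K.card * weightAbove E μ K

/-- The concave functional whose maximiser determines the container. -/
def objective (E : ι → Finset W) (a : ℝ) (S : Finset W) (μ : ι → ℝ) : ℝ :=
  2 * ∑ i, μ i - energy E a S μ μ

/-- `μ` maximises the objective over all nonnegative measures. -/
def IsOptimal (E : ι → Finset W) (a : ℝ) (S : Finset W) (μ : ι → ℝ) : Prop :=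
  (∀ i, 0 ≤ μ i) ∧ ∀ ν : ι → ℝ, (∀ i, 0 ≤ ν i) → objective E a S ν ≤ objective E a S μ

variable {E : ι → Finset W} {a : ℝ} {S : Finset W} {μ ν : ι → ℝ}

omit [Fintype W] in
lemma weightAbove_nonneg (hμ : ∀ i, 0 ≤ μ i) (K : Finset W) : 0 ≤ weightAbove E μ K :=
  sum_nonneg fun i _ => by split_ifs <;> simp [hμ i]

omit [Fintype W] in
lemma weightAbove_add_smul (t : ℝ) (K : Finset W) :
    weightAbove E (fun i => μ i + t * ν i) K = weightAbove E μ K + t * weightAbove E ν K := by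
  simp only [weightAbove, mul_sum, ← sum_add_distrib]
  refine sum_congr rfl fun i _ => ?_
  split_ifs <;> simp

lemma energy_eq_sum_potential : energy E a S μ ν = ∑ i, ν i * potential E a S μ i := by
  simp only [energy, potential, sum_filter, mul_sum]
  rw [sum_comm]
  refine sum_congr rfl fun K _ => ?_
  rw [weightAbove.eq_1 E ν, mul_sum]
  refine sum_congr rfl fun i _ => ?_
  split_ifs <;> ring

lemma energy_add_smul (t : ℝ) :
    energy E a S (fun i => μ i + t * ν i) (fun i => μ i + t * ν i) =
      energy E a S μ μ + 2 * t * energy E a S μ ν + t ^ 2 * energy E a S ν ν := by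
  simp only [energy, weightAbove_add_smul, mul_sum, ← sum_add_distrib]
  exact sum_congr rfl fun K _ => by ring

lemma objective_add_smul (t : ℝ) :
    objective E a S (fun i => μ i + t * ν i) =
      objective E a S μ + 2 * t * (∑ i, ν i - energy E a S μ ν) - t ^ 2 * energy E a S ν ν := by
  simp only [objective, energy_add_smul, sum_add_distrib, ← mul_sum]
  ring

lemma energy_self_nonneg (ha : 0 < a) : 0 ≤ energy E a S μ μ :=
  sum_nonneg fun K _ => by rw [mul_assoc]; exact mul_nonneg (by positivity) (mul_self_nonneg _)

/-- Every edge meets the complement of `S`, so the singletons alone make the energy quadratic. -/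
lemma mul_sq_sum_le_card_mul_energy (ha : 0 < a) (hS : ∀ i, ¬ E i ⊆ S) (hμ : ∀ i, 0 ≤ μ i) :
    a * (∑ i, μ i) ^ 2 ≤ Fintype.card W * energy E a S μ μ := by
  have h1 : ∑ i, μ i ≤ ∑ v ∈ Sᶜ, weightAbove E μ {v} := by
    simp only [weightAbove]
    rw [sum_comm]
    refine sum_le_sum fun i _ => ?_
    obtain ⟨v, hv, hvS⟩ := not_subset.1 (hS i)
    refine le_trans (le_of_eq ?_) (single_le_sum (f := fun v => if {v} ⊆ E i then μ i else 0)
      (fun v _ => ?_) (mem_compl.2 hvS))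
    · simp [hv]
    · split_ifs <;> simp [hμ i]
  have h2 : a * ∑ v ∈ Sᶜ, weightAbove E μ {v} ^ 2 ≤ energy E a S μ μ := by
    rw [mul_sum, energy]
    rw [← sum_image (s := Sᶜ) (g := fun v : W => ({v} : Finset W))
      (f := fun K : Finset W => a * weightAbove E μ K ^ 2) (by intro x _ y _ h; simpa using h)]
    refine le_trans (sum_le_sum (g := fun K => a ^ K.card * weightAbove E μ K * weightAbove E μ K)
      fun K hK => ?_) (sum_le_sum_of_subset_of_nonneg ?_ fun K _ _ => ?_)
    · obtain ⟨v, _, rfl⟩ := mem_image.1 hK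
      simp only [card_singleton, pow_one]
      exact le_of_eq (by ring)
    · intro K hK
      obtain ⟨v, hv, rfl⟩ := mem_image.1 hK
      simpa [testSets] using hv
    · rw [mul_assoc]; exact mul_nonneg (by positivity) (mul_self_nonneg _)
  have h3 : (∑ v ∈ Sᶜ, weightAbove E μ {v}) ^ 2 ≤
      Fintype.card W * ∑ v ∈ Sᶜ, weightAbove E μ {v} ^ 2 := by
    refine le_trans sq_sum_le_card_mul_sum_sq ?_
    refine mul_le_mul_of_nonneg_right ?_ (sum_nonneg fun v _ => sq_nonneg _)
    exact_mod_cast card_le_univ _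
  have h0 : (0 : ℝ) ≤ ∑ i, μ i := sum_nonneg fun i _ => hμ i
  calc a * (∑ i, μ i) ^ 2 ≤ a * (∑ v ∈ Sᶜ, weightAbove E μ {v}) ^ 2 := by gcongr
    _ ≤ a * (Fintype.card W * ∑ v ∈ Sᶜ, weightAbove E μ {v} ^ 2) := by gcongr
    _ = Fintype.card W * (a * ∑ v ∈ Sᶜ, weightAbove E μ {v} ^ 2) := by ring
    _ ≤ _ := by gcongr

lemma objective_zero : objective E a S (0 : ι → ℝ) = 0 := by
  simp [objective, energy, weightAbove]

/-- Coercivity: the quadratic lower bound on the energy makes the objective at most `0`, its value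
at the zero measure, once the mass exceeds `2|W|/a`. A maximiser over a compact box is therefore
global. -/
lemma exists_isOptimal [Nonempty W] (ha : 0 < a) (hS : ∀ i, ¬ E i ⊆ S) :
    ∃ μ, IsOptimal E a S μ := by
  set R : ℝ := 2 * Fintype.card W / a with hR
  have hN : (0 : ℝ) < Fintype.card W := by exact_mod_cast Fintype.card_pos
  have hR0 : 0 ≤ R := by positivity
  have hcont : Continuous (objective E a S) := by
    unfold objective energy weightAbove
    refine Continuous.sub (by fun_prop) (continuous_finsetSum _ fun K _ => ?_)
    have hK : Continuous fun μ : ι → ℝ => ∑ i, if K ⊆ E i then μ i else 0 := by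
      refine continuous_finsetSum _ fun i _ => ?_
      split_ifs <;> fun_prop
    fun_prop
  obtain ⟨μ, hμ, hmax⟩ := (isCompact_Icc (a := (0 : ι → ℝ)) (b := fun _ => R)).exists_isMaxOn
    ⟨0, le_rfl, fun _ => hR0⟩ hcont.continuousOn
  refine ⟨μ, hμ.1, fun ν hν => ?_⟩
  by_cases h : ∀ i, ν i ≤ R
  · exact hmax ⟨hν, h⟩
  · push Not at h
    obtain ⟨i, hi⟩ := h
    have h1 : R < ∑ j, ν j := hi.trans_le (single_le_sum (fun j _ => hν j) (mem_univ i))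
    have h2 := mul_sq_sum_le_card_mul_energy ha hS hν
    have h3 : objective E a S 0 ≤ objective E a S μ := hmax ⟨le_rfl, fun _ => hR0⟩
    rw [objective_zero] at h3
    refine le_trans ?_ h3
    have h4 : 2 * Fintype.card W < a * ∑ j, ν j := by
      rw [hR, div_lt_iff₀ ha] at h1; linarith
    have h5 : (Fintype.card W : ℝ) * objective E a S ν ≤ 0 := by
      rw [objective]; nlinarith
    by_contra! h6
    nlinarith [mul_pos hN h6]

namespace IsOptimal

/-- First-order condition: the derivative of the objective towards a point mass at `i` is twice `1 -
potential`, which cannot be positive at a maximum. -/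
lemma one_le_potential (ha : 0 < a) (h : IsOptimal E a S μ) (i : ι) :
    1 ≤ potential E a S μ i := by
  classical
  by_contra! hlt
  set δ : ι → ℝ := Pi.single i 1 with hδ
  have hδ0 : ∀ j, 0 ≤ δ j := fun j => by
    rw [hδ]; by_cases hj : j = i
    · subst hj; simp
    · simp [hj]
  have hsum : ∑ j, δ j = 1 := by simp [hδ]
  have hen : energy E a S μ δ = potential E a S μ i := by
    rw [energy_eq_sum_potential, sum_eq_single i] <;> simp +contextual [hδ]
  have hq := energy_self_nonneg (E := E) (S := S) (μ := δ) ha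
  set Q := energy E a S δ δ
  set x := 1 - potential E a S μ i with hx
  have hx0 : 0 < x := by linarith
  have hobj := h.2 (fun j => μ j + x / (Q + 1) * δ j) fun j =>
    add_nonneg (h.1 j) (mul_nonneg (by positivity) (hδ0 j))
  rw [objective_add_smul, hsum, hen] at hobj
  have h1 : 0 < x / (Q + 1) := by positivity
  have h2 : x / (Q + 1) * Q ≤ x := by
    rw [div_mul_eq_mul_div, div_le_iff₀ (by positivity)]; nlinarith
  have h3 : 2 * (x / (Q + 1)) * x - (x / (Q + 1)) ^ 2 * Q ≤ 0 := by linarith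
  nlinarith [mul_pos h1 hx0, mul_le_mul_of_nonneg_left h2 h1.le]

/-- Optimality along the ray through `μ`: with mass `m` and energy `Q > 0`, the objective `2um -
u²Q` of `u • μ` peaks at `u = m / Q`, which must be `1`. -/
lemma energy_eq_sum (ha : 0 < a) (hS : ∀ i, ¬ E i ⊆ S) (h : IsOptimal E a S μ) :
    energy E a S μ μ = ∑ i, μ i := by
  have hQ := energy_self_nonneg (E := E) (S := S) (μ := μ) ha
  have hm := mul_sq_sum_le_card_mul_energy ha hS h.1
  have hm0 : (0 : ℝ) ≤ ∑ i, μ i := sum_nonneg fun i _ => h.1 i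
  set m := ∑ i, μ i with hmdef
  rcases hQ.eq_or_lt with h0 | h0
  · rw [← h0] at hm ⊢
    have : m ^ 2 ≤ 0 := by
      by_contra! hlt
      nlinarith [mul_pos ha hlt]
    nlinarith
  · have hobj := h.2 (fun i => μ i + (m / energy E a S μ μ - 1) * μ i) fun i => by
      have := h.1 i
      have : 0 ≤ m / energy E a S μ μ * μ i := by positivity
      linarith
    rw [objective_add_smul, ← hmdef] at hobj
    set Q := energy E a S μ μ
    have hmQ : m / Q * Q = m := div_mul_cancel₀ _ h0.ne'
    set u := m / Q
    have : (u - 1) ^ 2 * Q ≤ 0 := by rw [← hmQ] at hobj; nlinarith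
    have h1 : (u - 1) ^ 2 = 0 := by
      by_contra hne
      have : 0 < (u - 1) ^ 2 := lt_of_le_of_ne (sq_nonneg _) (Ne.symm hne)
      nlinarith [mul_pos this h0]
    have h2 : u = 1 := by nlinarith [pow_eq_zero_iff (two_ne_zero) |>.1 h1]
    rw [← hmQ, h2, one_mul]

/-- Complementary slackness: the terms `μ j * (potential - 1)` are nonnegative and sum to energy
minus mass, which is `0`. -/
lemma mul_potential (ha : 0 < a) (hS : ∀ i, ¬ E i ⊆ S) (h : IsOptimal E a S μ) (i : ι) :
    μ i * potential E a S μ i = μ i := by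
  have h1 : ∑ j, (μ j * potential E a S μ j - μ j) = 0 := by
    rw [sum_sub_distrib, ← energy_eq_sum_potential, h.energy_eq_sum ha hS, sub_self]
  have h2 := (sum_eq_zero_iff_of_nonneg fun j _ => by
    nlinarith [h.1 j, h.one_le_potential ha j]).1 h1 i (mem_univ i)
  linarith

lemma objective_eq_sum (ha : 0 < a) (hS : ∀ i, ¬ E i ⊆ S) (h : IsOptimal E a S μ) :
    objective E a S μ = ∑ i, μ i := by
  rw [objective, h.energy_eq_sum ha hS]; ring

/-- This cap on the optimum limits how long the fingerprint can grow. -/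
lemma mul_sum_le_card (ha : 0 < a) (hS : ∀ i, ¬ E i ⊆ S) (h : IsOptimal E a S μ) :
    a * ∑ i, μ i ≤ Fintype.card W := by
  have h1 := mul_sq_sum_le_card_mul_energy ha hS h.1
  rw [h.energy_eq_sum ha hS] at h1
  have hm0 : (0 : ℝ) ≤ ∑ i, μ i := sum_nonneg fun i _ => h.1 i
  rcases hm0.eq_or_lt with h0 | h0
  · rw [← h0]; simp
  · nlinarith

/-- Adding to the fingerprint a vertex of large weight increases the optimum substantially. -/
lemma add_le_sum_insert (ha : 0 < a) {v : W} (hv : v ∉ S) (hS : ∀ i, ¬ E i ⊆ insert v S)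
    (h : IsOptimal E a S μ) {μ' : ι → ℝ} (h' : IsOptimal E a (insert v S) μ') :
    ∑ i, μ i + (a * weightAbove E μ {v}) ^ 3 ≤ ∑ i, μ' i := by
  have hS0 : ∀ i, ¬ E i ⊆ S := fun i hi => hS i (hi.trans (subset_insert _ _))
  set y := weightAbove E μ {v} with hy
  have hy0 : 0 ≤ y := weightAbove_nonneg h.1 _
  -- The competitor for `insert v S` is `μ` plus a multiple of its restriction to the edges through
  -- `v`.
  set ν : ι → ℝ := fun i => if v ∈ E i then μ i else 0 with hν
  have hν0 : ∀ i, 0 ≤ ν i := fun i => by simp only [hν]; split_ifs <;> simp [h.1 i]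
  have hνsum : ∑ i, ν i = y := by simp [hy, hν, weightAbove]
  have hsub : testSets (insert v S) ⊆ testSets S := fun K hK => by
    simp only [testSets, mem_filter, mem_univ, true_and, disjoint_insert_right] at hK ⊢
    exact ⟨hK.1, hK.2.2⟩
  have hterm : ∀ K : Finset W, 0 ≤ a ^ K.card * weightAbove E μ K := fun K =>
    mul_nonneg (by positivity) (weightAbove_nonneg h.1 K)
  have h1 : energy E a (insert v S) μ μ ≤ ∑ i, μ i := by
    rw [← h.energy_eq_sum ha hS0]
    exact sum_le_sum_of_subset_of_nonneg hsub fun K _ _ =>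
      mul_nonneg (hterm K) (weightAbove_nonneg h.1 K)
  -- An edge through `v` loses the term `K = {v}`, worth `a * y`, from its potential.
  have h2 : energy E a (insert v S) μ ν ≤ y * (1 - a * y) := by
    rw [energy_eq_sum_potential, ← hνsum, sum_mul, hνsum]
    refine sum_le_sum fun i _ => ?_
    by_cases hvi : v ∈ E i
    · have hpot : potential E a (insert v S) μ i + a * y ≤ potential E a S μ i := by
        have hnot : ({v} : Finset W) ∉ (testSets (insert v S)).filter (· ⊆ E i) := by
          simp [testSets]
        have hle : ∑ K ∈ insert {v} ((testSets (insert v S)).filter (· ⊆ E i)),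
            a ^ K.card * weightAbove E μ K ≤ potential E a S μ i := by
          refine sum_le_sum_of_subset_of_nonneg ?_ fun K _ _ => hterm K
          refine insert_subset ?_ (filter_subset_filter _ hsub)
          simp [testSets, hv, hvi]
        rw [sum_insert hnot, card_singleton, pow_one] at hle
        rw [potential]
        linarith
      simp only [hν, hvi, if_true]
      have h3 := h.mul_potential ha hS0 i
      have h4 := mul_le_mul_of_nonneg_left hpot (h.1 i)
      nlinarith
    · simp [hν, hvi]
  -- Adjoining `v` to each test set embeds this sum into the energy of `μ` and `ν` relative to `S`,
  -- where potentials equal `1` on the support of `μ`.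
  have h3 : a * energy E a (insert v S) ν ν ≤ y := by
    have hdeg : ∀ K, weightAbove E ν K = weightAbove E μ (insert v K) := fun K => by
      simp only [weightAbove, hν, insert_subset_iff]
      exact sum_congr rfl fun i _ => by by_cases h1 : v ∈ E i <;> simp [h1]
    have hinj : Set.InjOn (fun K : Finset W => insert v K) (testSets (insert v S)) := by
      intro K hK K' hK' hKK
      simp only [testSets, coe_filter, mem_univ, true_and, disjoint_insert_right,
        Set.mem_ofPred_eq] at hK hK'
      rw [← erase_insert hK.2.1, ← erase_insert hK'.2.1]
      exact congrArg (fun X => X.erase v) hKK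
    have e1 : a * energy E a (insert v S) ν ν =
        ∑ K ∈ (testSets (insert v S)).image (fun K => insert v K),
          a ^ K.card * weightAbove E μ K * weightAbove E μ K := by
      rw [sum_image hinj, energy, mul_sum]
      refine sum_congr rfl fun K hK => ?_
      simp only [testSets, mem_filter, mem_univ, true_and, disjoint_insert_right] at hK
      rw [card_insert_of_notMem hK.2.1, hdeg, pow_succ]
      ring
    have e2 : a * energy E a (insert v S) ν ν ≤
        ∑ K ∈ testSets S, a ^ K.card * weightAbove E μ K * weightAbove E ν K := by
      rw [e1]
      refine le_trans (sum_le_sum (g := fun K =>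
        a ^ K.card * weightAbove E μ K * weightAbove E ν K) fun K hK => ?_)
        (sum_le_sum_of_subset_of_nonneg ?_ fun K _ _ => mul_nonneg (hterm K)
          (weightAbove_nonneg hν0 K))
      · obtain ⟨K', _, rfl⟩ := mem_image.1 hK
        rw [hdeg, insert_idem]
      · intro K hK
        obtain ⟨K', hK', rfl⟩ := mem_image.1 hK
        have := hsub hK'
        simp only [testSets, mem_filter, mem_univ, true_and] at this ⊢
        exact ⟨insert_nonempty _ _, disjoint_insert_left.2 ⟨hv, this.2⟩⟩
    refine e2.trans ?_
    change energy E a S μ ν ≤ y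
    rw [energy_eq_sum_potential, ← hνsum]
    refine sum_le_sum fun i _ => ?_
    simp only [hν]
    split_ifs
    · exact (h.mul_potential ha hS0 i).le
    · simp
  -- The coefficient `t = a²y` maximises the guaranteed gain `2t·ay² - t²y/a`, giving `(ay)³`.
  have hobj := h'.2 (fun i => μ i + a ^ 2 * y * ν i) fun i =>
    add_nonneg (h.1 i) (mul_nonneg (by positivity) (hν0 i))
  rw [h'.objective_eq_sum ha hS, objective_add_smul, hνsum, objective] at hobj
  have h4 : 2 * (a ^ 2 * y) * energy E a (insert v S) μ ν ≤
      2 * (a ^ 2 * y) * (y * (1 - a * y)) := by gcongr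
  have h5 : (a ^ 2 * y) ^ 2 * energy E a (insert v S) ν ν ≤ a ^ 3 * y ^ 2 * y := by
    have := mul_le_mul_of_nonneg_left h3 (show 0 ≤ a ^ 3 * y ^ 2 by positivity)
    linarith
  linarith

end IsOptimal

/-- Otherwise the potential of `E i` would be at most `(1 + aq)^s - 1 ≤ exp(1/2) - 1 < 1`, against
the first-order condition. -/
lemma exists_le_weightAbove {s : ℕ} {q : ℝ} (hs : 1 ≤ s) (hE : ∀ i, (E i).card ≤ s) (ha : 0 < a)
    (haq : a * q = 1 / (2 * s)) (h : IsOptimal E a S μ) (i : ι) :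
    ∃ K ∈ testSets S, K ⊆ E i ∧ q ^ K.card ≤ weightAbove E μ K := by
  by_contra! hlt
  have hs0 : (0 : ℝ) < s := by exact_mod_cast hs
  have h1 : potential E a S μ i ≤ ∑ K ∈ (E i).powerset.erase ∅, (a * q) ^ K.card := by
    have haq0 : 0 ≤ a * q := by rw [haq]; positivity
    refine le_trans (sum_le_sum (g := fun K : Finset W => (a * q) ^ K.card) fun K hK => ?_)
      (sum_le_sum_of_subset_of_nonneg ?_ fun K _ _ => by positivity)
    · obtain ⟨hK1, hK2⟩ := mem_filter.1 hK
      rw [mul_pow]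
      exact mul_le_mul_of_nonneg_left (hlt K hK1 hK2).le (by positivity)
    · intro K hK
      simp only [testSets, mem_filter, mem_univ, true_and] at hK
      simp [hK.1.1.ne_empty, hK.2]
  have h2 : ∑ K ∈ (E i).powerset, (a * q) ^ K.card = (a * q + 1) ^ (E i).card := by
    rw [← sum_pow_mul_eq_add_pow]; simp
  have h3 : (a * q + 1) ^ (E i).card < 2 := by
    have h4 : a * q + 1 ≤ Real.exp (1 / (2 * s)) := by rw [haq]; exact Real.add_one_le_exp _
    have h5 : (a * q + 1) ^ (E i).card ≤ (a * q + 1) ^ s :=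
      pow_le_pow_right₀ (by rw [haq]; linarith [show (0 : ℝ) ≤ 1 / (2 * s) by positivity]) (hE i)
    have h6 : (a * q + 1) ^ s ≤ Real.exp (1 / 2) := by
      refine (pow_le_pow_left₀ (by rw [haq]; positivity) h4 s).trans (le_of_eq ?_)
      rw [← Real.exp_nat_mul]; congr 1; field_simp
    have h7 : Real.exp (1 / 2) < 2 := by
      have : Real.exp (1 / 2) ^ 2 < 4 := by
        rw [← Real.exp_nat_mul]; norm_num; linarith [Real.exp_one_lt_d9]
      nlinarith [Real.exp_pos (1 / 2)]
    linarith
  have h4 := add_sum_erase (E i).powerset (fun K => (a * q) ^ K.card) (empty_mem_powerset _)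
  simp only [card_empty, pow_zero] at h4
  linarith [h.one_le_potential ha i]

/-- A hypergraph container lemma with polynomial dependence on the uniformity: every independent
set `I` has a small fingerprint `S ⊆ I` such that `I` lies in `S ∪ f S` and the edges inside
`f S` are covered by sets of size at least two of small total weight. -/
theorem exists_container [Nonempty W] (E : ι → Finset W) {s : ℕ} (hs : 1 ≤ s)
    (hE : ∀ i, (E i).card ≤ s) {p : ℝ} (hp : 0 < p) :
    ∃ (f : Finset W → Finset W) (cover : Finset W → Finset (Finset W)),
      ∀ I : Finset W, (∀ i, ¬ E i ⊆ I) → ∃ S ⊆ I,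
        (S.card : ℝ) ≤ 32 * s ^ 5 * p * Fintype.card W ∧ I ⊆ S ∪ f S ∧
        (∀ K ∈ cover S, 2 ≤ K.card) ∧ (∀ i, E i ⊆ f S → ∃ K ∈ cover S, K ⊆ E i) ∧
        ∑ K ∈ cover S, p ^ K.card ≤ 4 * s ^ 2 * p * Fintype.card W := by
  classical
  have hs0 : (0 : ℝ) < s := by exact_mod_cast hs
  -- Two demands fix `q` and `a`: `aq = 1/(2s)` for the existence of heavy sets, and `aq² = p` to
  -- compare cover weight with energy.
  set q : ℝ := 2 * s * p with hq
  set a : ℝ := 1 / (4 * s ^ 2 * p) with ha_def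
  have ha : 0 < a := by positivity
  have hq0 : 0 < q := by positivity
  have haq : a * q = 1 / (2 * s) := by rw [hq, ha_def]; field_simp; ring
  have haqq : a * q * q = p := by rw [haq, hq]; field_simp
  have hopt : ∀ S : Finset W, ∃ μ : ι → ℝ, (∀ i, ¬ E i ⊆ S) → IsOptimal E a S μ := fun S => by
    by_cases hS : ∀ i, ¬ E i ⊆ S
    · obtain ⟨μ, hμ⟩ := exists_isOptimal ha hS
      exact ⟨μ, fun _ => hμ⟩
    -- If `S` contains an edge, mass there costs no energy and no optimum exists; such `S` never lie
    -- inside an independent set.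
    · exact ⟨0, fun h => absurd h hS⟩
  choose μ hμ using hopt
  refine ⟨fun S => univ.filter fun v => v ∉ S ∧ weightAbove E (μ S) {v} < q,
    fun S => (testSets S).filter fun K => q ^ K.card ≤ weightAbove E (μ S) K ∧ 2 ≤ K.card,
    fun I hI => ?_⟩
  have hind : ∀ S ⊆ I, ∀ i, ¬ E i ⊆ S := fun S hS i h => hI i (h.trans hS)
  -- `g = (aq)³` is the gain from inserting a vertex of weight at least `q`, so a largest `S ⊆ I`
  -- with mass at least `g|S|` leaves no such vertex in `I \ S`.
  set g : ℝ := 1 / (8 * s ^ 3) with hg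
  have hg0 : 0 < g := by positivity
  obtain ⟨S, hSmem, hSmax⟩ := exists_max_image
    (I.powerset.filter fun S => g * S.card ≤ ∑ i, μ S i) card
    ⟨∅, by
      simp only [mem_filter, mem_powerset, empty_subset, true_and, card_empty, Nat.cast_zero,
        mul_zero]
      exact sum_nonneg fun i _ => (hμ ∅ (hind ∅ (empty_subset _))).1 i⟩
  simp only [mem_filter, mem_powerset] at hSmem hSmax
  obtain ⟨hSI, hSg⟩ := hSmem
  have hS := hμ S (hind S hSI)
  have hsum : ∑ i, μ S i ≤ 4 * s ^ 2 * p * Fintype.card W := by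
    have := hS.mul_sum_le_card ha (hind S hSI)
    rw [ha_def, one_div, inv_mul_le_iff₀ (by positivity)] at this
    exact this
  refine ⟨S, hSI, ?_, fun v hv => ?_, fun K hK => (mem_filter.1 hK).2.2, fun i hi => ?_, ?_⟩
  · have : g * S.card ≤ 4 * s ^ 2 * p * Fintype.card W := hSg.trans hsum
    rw [hg, one_div, inv_mul_le_iff₀ (by positivity)] at this
    exact this.trans (le_of_eq (by ring))
  · by_cases hvS : v ∈ S
    · exact mem_union_left _ hvS
    refine mem_union_right _ (mem_filter.2 ⟨mem_univ _, hvS, ?_⟩)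
    by_contra! hge
    have hins : insert v S ⊆ I := insert_subset hv hSI
    have h1 := hS.add_le_sum_insert ha hvS (hind _ hins) (hμ _ (hind _ hins))
    have h2 : g ≤ (a * weightAbove E (μ S) {v}) ^ 3 := by
      have : 1 / (2 * s) ≤ a * weightAbove E (μ S) {v} := by
        rw [← haq]; gcongr
      refine le_trans (le_of_eq ?_) (pow_le_pow_left₀ (by positivity) this 3)
      rw [hg]; field_simp; norm_num
    have h3 := hSmax (insert v S) ⟨hins, by
      rw [card_insert_of_notMem hvS]; push_cast; linarith⟩
    rw [card_insert_of_notMem hvS] at h3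
    omega
  · obtain ⟨K, hK, hKE, hKq⟩ := exists_le_weightAbove hs hE ha haq hS i
    refine ⟨K, mem_filter.2 ⟨hK, hKq, ?_⟩, hKE⟩
    have hne : K.Nonempty := (mem_filter.1 hK).2.1
    by_contra! hcard
    have h1 : K.card = 1 := by have := hne.card_pos; omega
    obtain ⟨v, rfl⟩ := card_eq_one.1 h1
    have := (mem_filter.1 (hi (hKE (mem_singleton_self v)))).2.2
    simp only [card_singleton, pow_one] at hKq
    linarith
  · refine le_trans ?_ hsum
    -- A set `K` of the cover has energy term at least `a^|K| q^(2|K|) = p^|K|`.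
    rw [← hS.energy_eq_sum ha (hind S hSI), energy]
    refine le_trans (sum_le_sum fun K hK => ?_) (sum_le_sum_of_subset_of_nonneg
      (filter_subset _ _) fun K _ _ => ?_)
    · have h1 := (mem_filter.1 hK).2.1
      have h2 : 0 ≤ weightAbove E (μ S) K := weightAbove_nonneg hS.1 K
      rw [← haqq, mul_pow, mul_pow]
      gcongr
    · rw [mul_assoc]
      exact mul_nonneg (by positivity) (mul_self_nonneg _)

end HypergraphContainer

/-! ### Supersaturated stability for cliques -/

namespace SimpleGraph

open Finset

variable {V : Type*} [DecidableEq V] (G : SimpleGraph V) [DecidableRel G.Adj]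

/-- The number of adjacent ordered pairs in `X × Y`, as a real number. -/
def adjPairs (X Y : Finset V) : ℝ := ∑ x ∈ X, ∑ y ∈ Y, if G.Adj x y then 1 else 0

/-- The number of adjacent ordered pairs in `A × A` whose members have the same colour. -/
def monoPairs {C : Type*} [DecidableEq C] (A : Finset V) (c : V → C) : ℝ :=
  ∑ x ∈ A, ∑ y ∈ A, if c x = c y then (if G.Adj x y then 1 else 0) else 0

/-- The number of ordered cliques of size `k` in `A`, as a real number. -/
def orderedCliques : ℕ → Finset V → ℝ
  | 0, _ => 1
  | k + 1, A => ∑ x ∈ A, orderedCliques k (A.filter (G.Adj x))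

omit [DecidableEq V] in
lemma orderedCliques_nonneg (k : ℕ) (A : Finset V) : 0 ≤ G.orderedCliques k A := by
  induction k generalizing A with
  | zero => simp [orderedCliques]
  | succ k ih => exact sum_nonneg fun x _ => ih _

omit [DecidableEq V] in
lemma adjPairs_comm (X Y : Finset V) : G.adjPairs X Y = G.adjPairs Y X := by
  rw [adjPairs, sum_comm, adjPairs]
  simp only [G.adj_comm]

omit [DecidableEq V] in
lemma adjPairs_filter_add_left (X Y : Finset V) (P : V → Prop) [DecidablePred P] :
    G.adjPairs (X.filter P) Y + G.adjPairs (X.filter fun x => ¬ P x) Y = G.adjPairs X Y :=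
  sum_filter_add_sum_filter_not _ _ _

omit [DecidableEq V] in
lemma adjPairs_filter_add_right (X Y : Finset V) (P : V → Prop) [DecidablePred P] :
    G.adjPairs X (Y.filter P) + G.adjPairs X (Y.filter fun x => ¬ P x) = G.adjPairs X Y := by
  rw [adjPairs_comm, G.adjPairs_comm X, adjPairs_filter_add_left, adjPairs_comm]

omit [DecidableEq V] in
lemma adjPairs_eq_sum_card (X Y : Finset V) :
    G.adjPairs X Y = ∑ x ∈ X, ((Y.filter (G.Adj x)).card : ℝ) := by
  simp [adjPairs, sum_boole]

omit [DecidableEq V] in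
/-- A new colour class, the set of non-neighbours of `x`, extends a colouring of the
neighbourhood of `x`. -/
lemma monoPairs_extend {r : ℕ} (A : Finset V) (x : V) (c : V → Fin r) :
    G.monoPairs A (fun v => if G.Adj x v then (c v).castSucc else Fin.last r) =
      G.monoPairs (A.filter (G.Adj x)) c +
        G.adjPairs (A.filter fun v => ¬ G.Adj x v) (A.filter fun v => ¬ G.Adj x v) := by
  unfold monoPairs adjPairs
  rw [← sum_filter_add_sum_filter_not A (G.Adj x)]
  congr 1
  · refine sum_congr rfl fun u hu => ?_
    rw [← sum_filter_add_sum_filter_not A (G.Adj x)]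
    have hu := (mem_filter.1 hu).2
    rw [add_eq_left.2]
    · refine sum_congr rfl fun w hw => ?_
      have hw := (mem_filter.1 hw).2
      simp [hu, hw]
    · refine sum_eq_zero fun w hw => ?_
      have hw := (mem_filter.1 hw).2
      simp [hu, hw]
  · refine sum_congr rfl fun u hu => ?_
    rw [← sum_filter_add_sum_filter_not A (G.Adj x)]
    have hu := (mem_filter.1 hu).2
    rw [add_eq_right.2]
    · refine sum_congr rfl fun w hw => ?_
      have hw := (mem_filter.1 hw).2
      simp [hu, hw]
    · refine sum_eq_zero fun w hw => ?_
      have hw := (mem_filter.1 hw).2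
      simp [hu, hw, (Fin.castSucc_lt_last _).ne']

/-- Some colouring with `r` colours makes at most one `r`-th of the pairs monochromatic. -/
lemma exists_mul_monoPairs_le {r : ℕ} (hr : 1 ≤ r) (A : Finset V) :
    ∃ c : V → Fin r, r * G.monoPairs A c ≤ G.adjPairs A A := by
  have : NeZero r := ⟨by omega⟩
  induction A using Finset.induction_on with
  | empty => exact ⟨fun _ => 0, by simp [monoPairs, adjPairs]⟩
  | insert x A hx ih =>
    obtain ⟨c, hc⟩ := ih
    set h : Fin r → ℝ := fun j => ∑ y ∈ A, if c y = j then (if G.Adj x y then 1 else 0) else 0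
    have hsum : ∑ j, h j = ∑ y ∈ A, if G.Adj x y then (1 : ℝ) else 0 := by
      rw [sum_comm]
      exact sum_congr rfl fun y _ => by simp
    -- Greedy choice: `x` gets a colour that is at most averagely frequent among its neighbours in
    -- `A`.
    obtain ⟨j, -, hj⟩ := exists_le_of_sum_le (s := univ) (f := h)
      (g := fun _ => (∑ y ∈ A, if G.Adj x y then (1 : ℝ) else 0) / r) univ_nonempty (by
        rw [hsum, sum_const, card_univ, Fintype.card_fin, nsmul_eq_mul,
          mul_div_cancel₀ _ (by exact_mod_cast (NeZero.ne r))])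
    rw [le_div_iff₀ (by exact_mod_cast hr)] at hj
    refine ⟨Function.update c x j, ?_⟩
    have hne : ∀ y ∈ A, y ≠ x := fun y hy h => hx (h ▸ hy)
    have e1 : G.monoPairs (insert x A) (Function.update c x j) = 2 * h j + G.monoPairs A c := by
      unfold monoPairs
      rw [sum_insert hx, sum_insert hx]
      have a1 : ∑ y ∈ A, (if Function.update c x j x = Function.update c x j y then
          (if G.Adj x y then (1 : ℝ) else 0) else 0) = h j := by
        refine sum_congr rfl fun y hy => ?_
        simp [hne y hy, eq_comm]
      have a2 : ∑ y ∈ A, ∑ z ∈ insert x A, (if Function.update c x j y = Function.update c x j z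
          then (if G.Adj y z then (1 : ℝ) else 0) else 0) = h j + ∑ y ∈ A, ∑ z ∈ A,
            if c y = c z then (if G.Adj y z then (1 : ℝ) else 0) else 0 := by
        rw [← sum_add_distrib]
        refine sum_congr rfl fun y hy => ?_
        rw [sum_insert hx]
        congr 1
        · simp [hne y hy, G.adj_comm]
        · refine sum_congr rfl fun z hz => ?_
          simp [hne y hy, hne z hz]
      rw [a1, a2]
      simp; ring
    have e2 : G.adjPairs (insert x A) (insert x A) =
        2 * (∑ y ∈ A, if G.Adj x y then (1 : ℝ) else 0) + G.adjPairs A A := by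
      unfold adjPairs
      simp only [sum_insert hx, sum_add_distrib, G.irrefl, if_false, zero_add]
      simp only [G.adj_comm _ x]
      ring
    rw [e1, e2]
    linarith

omit [DecidableEq V] in
/-- Passing to the neighbourhood of `x` and its complement in `A`. -/
lemma adjPairs_filter_sub (A : Finset V) (x : V) :
    G.adjPairs (A.filter (G.Adj x)) (A.filter (G.Adj x)) -
      G.adjPairs (A.filter fun v => ¬ G.Adj x v) (A.filter fun v => ¬ G.Adj x v) =
      G.adjPairs A A - 2 * G.adjPairs (A.filter fun v => ¬ G.Adj x v) A := by
  have h1 := G.adjPairs_filter_add_left A A (G.Adj x)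
  have h2 := G.adjPairs_filter_add_right (A.filter (G.Adj x)) A (G.Adj x)
  have h3 := G.adjPairs_filter_add_right (A.filter fun v => ¬ G.Adj x v) A (G.Adj x)
  have h4 := G.adjPairs_comm (A.filter (G.Adj x)) (A.filter fun v => ¬ G.Adj x v)
  linarith

omit [DecidableEq V] in
/-- Rearrangement over the non-adjacent pairs. -/
lemma sum_pow_mul_adjPairs_le (A : Finset V) (k : ℕ) :
    ∑ x ∈ A, ((A.filter (G.Adj x)).card : ℝ) ^ k * G.adjPairs (A.filter fun v => ¬ G.Adj x v) A ≤
      ∑ x ∈ A, ((A.filter (G.Adj x)).card : ℝ) ^ k * ((A.filter (G.Adj x)).card *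
        (A.card - (A.filter (G.Adj x)).card)) := by
  set d : V → ℝ := fun x => ((A.filter (G.Adj x)).card : ℝ) with hd
  set w : V → V → ℝ := fun x v => if G.Adj x v then 0 else 1 with hw
  have hw0 : ∀ x v, 0 ≤ w x v := fun x v => by simp only [hw]; split_ifs <;> simp
  have hwc : ∀ x v, w x v = w v x := fun x v => by simp only [hw, G.adj_comm]
  have hd0 : ∀ x, 0 ≤ d x := fun x => by positivity
  have e1 : ∀ x ∈ A, d x ^ k * G.adjPairs (A.filter fun v => ¬ G.Adj x v) A =
      ∑ v ∈ A, w x v * (d x ^ k * d v) := fun x _ => by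
    rw [adjPairs_eq_sum_card, sum_filter, mul_sum]
    exact sum_congr rfl fun v _ => by by_cases h : G.Adj x v <;> simp [hw, hd, h]
  have e2 : ∀ x ∈ A, d x ^ k * (d x * (A.card - d x)) = ∑ v ∈ A, w x v * d x ^ (k + 1) :=
    fun x _ => by
    have : (A.card : ℝ) - d x = ∑ v ∈ A, w x v := by
      have h1 := card_filter_add_card_filter_not (s := A) (G.Adj x)
      have h2 : ∑ v ∈ A, w x v = ((A.filter fun v => ¬ G.Adj x v).card : ℝ) := by
        rw [card_filter]; push_cast
        exact sum_congr rfl fun v _ => by by_cases h : G.Adj x v <;> simp [hw, h]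
      rw [h2, ← h1]; simp [hd]
    rw [this, ← sum_mul]; ring
  rw [sum_congr rfl e1, sum_congr rfl e2]
  -- Symmetrising over non-adjacent pairs reduces the claim to `(d x ^ k - d v ^ k) * (d x - d v) ≥
  -- 0`.
  have s1 : ∑ x ∈ A, ∑ v ∈ A, w x v * (d x ^ k * d v) =
      ∑ x ∈ A, ∑ v ∈ A, w x v * (d v ^ k * d x) := by
    rw [sum_comm]
    exact sum_congr rfl fun x _ => sum_congr rfl fun v _ => by rw [hwc]
  have s2 : ∑ x ∈ A, ∑ v ∈ A, w x v * d x ^ (k + 1) =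
      ∑ x ∈ A, ∑ v ∈ A, w x v * d v ^ (k + 1) := by
    rw [sum_comm]
    exact sum_congr rfl fun x _ => sum_congr rfl fun v _ => by rw [hwc]
  have s3 : ∑ x ∈ A, ∑ v ∈ A, w x v * (d x ^ k * d v) +
      ∑ x ∈ A, ∑ v ∈ A, w x v * (d v ^ k * d x) ≤
      ∑ x ∈ A, ∑ v ∈ A, w x v * d x ^ (k + 1) + ∑ x ∈ A, ∑ v ∈ A, w x v * d v ^ (k + 1) := by
    simp only [← sum_add_distrib, ← mul_add]
    refine sum_le_sum fun x _ => sum_le_sum fun v _ => mul_le_mul_of_nonneg_left ?_ (hw0 x v)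
    have : 0 ≤ (d x ^ k - d v ^ k) * (d x - d v) := by
      rcases le_total (d x) (d v) with h | h
      · have := pow_le_pow_left₀ (hd0 x) h k
        exact mul_nonneg_of_nonpos_of_nonpos (by linarith) (by linarith)
      · have := pow_le_pow_left₀ (hd0 v) h k
        exact mul_nonneg (by linarith) (by linarith)
    rw [pow_succ, pow_succ]
    linarith
  linarith

lemma one_div_eight_le_pow (k : ℕ) : (1 / 8 : ℝ) ≤ ((k + 1) / (k + 3)) ^ k := by
  have h1 : ((k + 3) / (k + 1) : ℝ) ^ k ≤ 8 := by
    have : ((k + 3) / (k + 1) : ℝ) = 2 / (k + 1) + 1 := by field_simp; ring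
    have h2 : ((k + 3) / (k + 1) : ℝ) ≤ Real.exp (2 / (k + 1)) := by
      rw [this]; exact Real.add_one_le_exp _
    calc ((k + 3) / (k + 1) : ℝ) ^ k ≤ Real.exp (2 / (k + 1)) ^ k := by gcongr
      _ = Real.exp (k * (2 / (k + 1))) := by rw [← Real.exp_nat_mul]
      _ ≤ Real.exp 2 := by
        refine Real.exp_le_exp.2 ?_
        rw [mul_div_assoc', div_le_iff₀ (by positivity)]; linarith
      _ = Real.exp 1 ^ 2 := by rw [← Real.exp_nat_mul]; norm_num
      _ ≤ 8 := by nlinarith [Real.exp_one_lt_d9, Real.exp_pos 1]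
  rw [one_div, ← inv_div ((k : ℝ) + 3), inv_pow]
  exact inv_anti₀ (by positivity) h1

-- Power means: this average degree costs only `((k+1)/(k+3))^k ≥ e⁻² > 1/8`, a constant independent
-- of `k`.
omit [DecidableEq V] in
lemma pow_div_eight_le_sum_pow (A : Finset V) (k : ℕ)
    (h : ((k + 1) / (k + 3) : ℝ) * A.card ^ 2 ≤ G.adjPairs A A) :
    (A.card : ℝ) ^ (k + 1) / 8 ≤ ∑ x ∈ A, ((A.filter (G.Adj x)).card : ℝ) ^ k := by
  rcases A.eq_empty_or_nonempty with rfl | hA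
  · simp
  have ha : (0 : ℝ) < A.card := by exact_mod_cast hA.card_pos
  rcases k with _ | k
  · simp; linarith
  have h1 := pow_sum_div_card_le_sum_pow (s := A)
    (f := fun x => ((A.filter (G.Adj x)).card : ℝ)) (fun _ _ => by positivity) k
  rw [← adjPairs_eq_sum_card] at h1
  refine le_trans ?_ h1
  rw [le_div_iff₀ (by positivity)]
  have h2 := one_div_eight_le_pow (k + 1)
  calc (A.card : ℝ) ^ (k + 1 + 1) / 8 * A.card ^ k
      = 1 / 8 * (A.card ^ 2) ^ (k + 1) := by ring
    _ ≤ (((k + 1 : ℕ) + 1) / ((k + 1 : ℕ) + 3)) ^ (k + 1) * (A.card ^ 2) ^ (k + 1) := by gcongr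
    _ = ((((k + 1 : ℕ) + 1) / ((k + 1 : ℕ) + 3)) * (A.card : ℝ) ^ 2) ^ (k + 1) := by
        rw [mul_pow]
    _ ≤ _ := by gcongr

/-- Supersaturated stability: if every `(k + 1)`-colouring of `A` has at least `t` monochromatic
pairs, then `A` contains many cliques on `k + 2` vertices. -/
theorem le_orderedCliques (k : ℕ) (A : Finset V) (t : ℝ)
    (ht : ∀ c : V → Fin (k + 1), t ≤ G.monoPairs A c) :
    1 / 2 * (1 / 8) ^ k * (A.card : ℝ) ^ k *
      (G.adjPairs A A + t - (1 - 1 / (k + 1)) * A.card ^ 2) ≤ G.orderedCliques (k + 2) A := by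
  induction k generalizing A t with
  | zero =>
    -- With one colour all pairs are monochromatic, so `t ≤ e` and `(e + t)/2 ≤ e`; this is the
    -- source of the factor `1/2`.
    have h1 := ht fun _ => 0
    have h2 : G.monoPairs A (fun _ => (0 : Fin (0 + 1))) = G.adjPairs A A := by
      simp [monoPairs, adjPairs]
    have h3 : G.orderedCliques 2 A = G.adjPairs A A := by
      simp [orderedCliques, adjPairs_eq_sum_card]
    rw [h3]
    rw [h2] at h1
    simp
    linarith
  | succ k ih =>
    set e := G.adjPairs A A with he
    set d : V → ℝ := fun x => ((A.filter (G.Adj x)).card : ℝ) with hd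
    have hd0 : ∀ x, 0 ≤ d x := fun x => by positivity
    set B : ℝ := e + t - (1 - 1 / ((k + 1 : ℕ) + 1)) * A.card ^ 2 with hB
    rcases lt_or_ge B 0 with hneg | hpos
    · refine le_trans ?_ (G.orderedCliques_nonneg _ A)
      exact mul_nonpos_of_nonneg_of_nonpos (by positivity) hneg.le
    set C : ℝ := 1 / 2 * (1 / 8) ^ k with hC
    have hC0 : 0 ≤ C := by positivity
    have hk : (0 : ℝ) < k + 1 := by positivity
    -- Induction inside the neighbourhood of `x`: colourings there extend by making the
    -- non-neighbours a new class, so `t` drops only by the adjacent pairs among non-neighbours.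
    have h1 : ∀ x ∈ A, C * (d x ^ k * (e + t - (1 - 1 / (k + 1)) * d x ^ 2) -
        2 * (d x ^ k * G.adjPairs (A.filter fun v => ¬ G.Adj x v) A)) ≤
        G.orderedCliques (k + 2) (A.filter (G.Adj x)) := fun x _ => by
      have hx := ih (A.filter (G.Adj x))
        (t - G.adjPairs (A.filter fun v => ¬ G.Adj x v) (A.filter fun v => ¬ G.Adj x v))
        fun c => by
          have := ht fun v => if G.Adj x v then (c v).castSucc else Fin.last (k + 1)
          rw [monoPairs_extend] at this
          linarith
      have hs := G.adjPairs_filter_sub A x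
      refine le_trans (le_of_eq ?_) hx
      rw [show G.adjPairs (A.filter (G.Adj x)) (A.filter (G.Adj x)) +
        (t - G.adjPairs (A.filter fun v => ¬ G.Adj x v) (A.filter fun v => ¬ G.Adj x v)) =
        e - 2 * G.adjPairs (A.filter fun v => ¬ G.Adj x v) A + t by linarith]
      simp only [hd]
      ring
    have h2 : C * (∑ x ∈ A, d x ^ k * (e + t - (1 - 1 / (k + 1)) * d x ^ 2) -
        2 * ∑ x ∈ A, d x ^ k * (d x * (A.card - d x))) ≤ G.orderedCliques (k + 1 + 2) A := by
      change _ ≤ ∑ x ∈ A, G.orderedCliques (k + 2) (A.filter (G.Adj x))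
      refine le_trans ?_ (sum_le_sum h1)
      rw [← mul_sum, sum_sub_distrib, ← mul_sum]
      have := G.sum_pow_mul_adjPairs_le A k
      refine mul_le_mul_of_nonneg_left ?_ hC0
      linarith
    have h3 : ∑ x ∈ A, d x ^ k * B ≤ ∑ x ∈ A, d x ^ k * (e + t - (1 - 1 / (k + 1)) * d x ^ 2) -
        2 * ∑ x ∈ A, d x ^ k * (d x * (A.card - d x)) := by
      rw [mul_sum, ← sum_sub_distrib]
      refine sum_le_sum fun x _ => ?_
      -- The difference is a multiple of a square that vanishes at the Turán degree `d x =
      -- (k+1)/(k+2) · |A|`.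
      have hsq : (1 - 1 / (k + 1)) * d x ^ 2 + 2 * (d x * (A.card - d x)) ≤
          (1 - 1 / ((k + 1 : ℕ) + 1)) * (A.card : ℝ) ^ 2 := by
        have h := div_nonneg (sq_nonneg ((k + 2) * d x - (k + 1) * A.card))
          (show (0 : ℝ) ≤ (k + 1) * (k + 2) by positivity)
        have : (1 - 1 / ((k + 1 : ℕ) + 1)) * (A.card : ℝ) ^ 2 -
            ((1 - 1 / (k + 1)) * d x ^ 2 + 2 * (d x * (A.card - d x))) =
            ((k + 2) * d x - (k + 1) * A.card) ^ 2 / ((k + 1) * (k + 2)) := by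
          push_cast
          field_simp
          ring
        linarith
      have := mul_le_mul_of_nonneg_left hsq (pow_nonneg (hd0 x) k)
      rw [hB]
      nlinarith
    -- A good colouring gives `(k+2)t ≤ e`; combined with `B ≥ 0` this forces `(k+3)e ≥ (k+1)|A|²`.
    have h4 : ((k + 1) / (k + 3) : ℝ) * A.card ^ 2 ≤ e := by
      obtain ⟨c, hc⟩ := G.exists_mul_monoPairs_le (r := k + 2) (by omega) A
      have h5 := ht c
      push_cast at hc hB
      have h6 : (k + 2) * t ≤ e := le_trans (by gcongr) hc
      have h7 : (k + 2) * B = (k + 2) * e + (k + 2) * t - (k + 1) * (A.card : ℝ) ^ 2 := by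
        rw [hB]; field_simp; ring
      have h8 : 0 ≤ (k + 2) * B := by positivity
      rw [div_mul_eq_mul_div, div_le_iff₀ (by positivity)]
      linarith
    have h5 := G.pow_div_eight_le_sum_pow A k h4
    rw [← sum_mul] at h3
    calc 1 / 2 * (1 / 8) ^ (k + 1) * (A.card : ℝ) ^ (k + 1) * B
        = C * ((A.card : ℝ) ^ (k + 1) / 8 * B) := by rw [hC]; ring
      _ ≤ C * ((∑ x ∈ A, d x ^ k) * B) := by gcongr
      _ ≤ _ := (mul_le_mul_of_nonneg_left h3 hC0).trans h2

/-- The cliques with `k` vertices inside `A`. -/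
def cliquesIn (k : ℕ) (A : Finset V) : Finset (Finset V) :=
  (A.powersetCard k).filter fun T => ∀ x ∈ T, ∀ y ∈ T, x ≠ y → G.Adj x y

lemma mem_cliquesIn {k : ℕ} {A T : Finset V} : T ∈ G.cliquesIn k A ↔
    (T ⊆ A ∧ T.card = k) ∧ ∀ x ∈ T, ∀ y ∈ T, x ≠ y → G.Adj x y := by
  rw [cliquesIn, mem_filter, mem_powersetCard]

/-- Double counting of pairs `x ∈ T` with `T` a clique on `k + 1` vertices. -/
lemma sum_card_cliquesIn_le (k : ℕ) (A : Finset V) :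
    ∑ x ∈ A, (G.cliquesIn k (A.filter (G.Adj x))).card ≤
      (k + 1) * (G.cliquesIn (k + 1) A).card := by
  have h1 : ∑ x ∈ A, (bipartiteAbove (fun x T => x ∈ T) (G.cliquesIn (k + 1) A) x).card =
      ∑ T ∈ G.cliquesIn (k + 1) A, (bipartiteBelow (fun x T => x ∈ T) A T).card :=
    sum_card_bipartiteAbove_eq_sum_card_bipartiteBelow _
  have h2 : ∀ T ∈ G.cliquesIn (k + 1) A,
      (bipartiteBelow (fun x T => x ∈ T) A T).card ≤ k + 1 := fun T hT => by
    rw [← (mem_powersetCard.1 (mem_filter.1 hT).1).2]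
    exact card_le_card fun x hx => (mem_filter.1 hx).2
  have h3 : ∀ x ∈ A, (G.cliquesIn k (A.filter (G.Adj x))).card ≤
      (bipartiteAbove (fun x T => x ∈ T) (G.cliquesIn (k + 1) A) x).card := fun x hx => by
    have hnot : ∀ T ∈ G.cliquesIn k (A.filter (G.Adj x)), x ∉ T := fun T hT hxT => by
      have := (mem_powersetCard.1 (mem_filter.1 hT).1).1 hxT
      simp at this
    refine card_le_card_of_injOn (fun T => insert x T) (fun T hT => ?_) fun T hT T' hT' h => ?_
    · have hxT := hnot T hT
      obtain ⟨hT1, hT2⟩ := mem_filter.1 (mem_coe.1 hT)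
      obtain ⟨hTA, hTk⟩ := mem_powersetCard.1 hT1
      have hadj : ∀ y ∈ T, G.Adj x y := fun y hy => (mem_filter.1 (hTA hy)).2
      refine mem_coe.2 (mem_filter.2 ⟨mem_filter.2 ⟨mem_powersetCard.2 ⟨?_, ?_⟩, ?_⟩,
        mem_insert_self _ _⟩)
      · exact insert_subset hx (hTA.trans (filter_subset _ _))
      · rw [card_insert_of_notMem hxT, hTk]
      · intro u hu w hw huw
        rcases mem_insert.1 hu with rfl | hu' <;> rcases mem_insert.1 hw with rfl | hw'
        · exact absurd rfl huw
        · exact hadj w hw'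
        · exact (hadj u hu').symm
        · exact hT2 u hu' w hw' huw
    · rw [← erase_insert (hnot T hT), ← erase_insert (hnot T' hT')]
      exact congrArg (fun X => X.erase x) h
  calc _ ≤ _ := sum_le_sum h3
    _ = _ := h1
    _ ≤ ∑ T ∈ G.cliquesIn (k + 1) A, (k + 1) := sum_le_sum h2
    _ = _ := by rw [sum_const, smul_eq_mul, mul_comm]

lemma orderedCliques_le (k : ℕ) (A : Finset V) :
    G.orderedCliques k A ≤ k.factorial * (G.cliquesIn k A).card := by
  induction k generalizing A with
  | zero => simp [orderedCliques, cliquesIn, filter_singleton]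
  | succ k ih =>
    calc G.orderedCliques (k + 1) A
        ≤ ∑ x ∈ A, (k.factorial * (G.cliquesIn k (A.filter (G.Adj x))).card : ℝ) :=
          sum_le_sum fun x _ => ih _
      _ = k.factorial * ((∑ x ∈ A, (G.cliquesIn k (A.filter (G.Adj x))).card : ℕ) : ℝ) := by
          rw [← mul_sum]; push_cast; rfl
      _ ≤ k.factorial * (((k + 1) * (G.cliquesIn (k + 1) A).card : ℕ) : ℝ) := by
          gcongr
          exact G.sum_card_cliquesIn_le k A
      _ = _ := by rw [Nat.factorial_succ]; push_cast; ring

end SimpleGraph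

/-! ### Clique covers, distance from partite, and the Turán number -/

namespace SimpleGraph

open Finset

variable {V : Type*} [DecidableEq V]

/-- The edges of the complete graph on `T`. -/
def completeEdges (T : Finset V) : Finset (Sym2 V) := T.offDiag.image (Function.uncurry Sym2.mk)

lemma mk_mem_completeEdges {T : Finset V} {x y : V} :
    s(x, y) ∈ completeEdges T ↔ x ∈ T ∧ y ∈ T ∧ x ≠ y := by
  simp only [completeEdges, mem_image, mem_offDiag, Prod.exists]
  constructor
  · rintro ⟨a, b, ⟨ha, hb, hab⟩, h⟩
    rcases Sym2.eq_iff.1 h with ⟨rfl, rfl⟩ | ⟨rfl, rfl⟩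
    · exact ⟨ha, hb, hab⟩
    · exact ⟨hb, ha, hab.symm⟩
  · rintro ⟨hx, hy, h⟩
    exact ⟨x, y, ⟨hx, hy, h⟩, rfl⟩

lemma card_completeEdges (T : Finset V) : (completeEdges T).card = T.card.choose 2 :=
  Sym2.card_image_offDiag T

variable [Fintype V]

/-- The vertices covered by a set of edges. -/
def edgeSpan (K : Finset (Sym2 V)) : Finset V := univ.filter fun v => ∃ e ∈ K, v ∈ e

lemma edgeSpan_subset {K : Finset (Sym2 V)} {T : Finset V} (h : K ⊆ completeEdges T) :
    edgeSpan K ⊆ T := fun v hv => by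
  obtain ⟨e, he, hve⟩ := (mem_filter.1 hv).2
  obtain ⟨w, rfl⟩ := Sym2.mem_iff_exists.1 hve
  exact (mk_mem_completeEdges.1 (h he)).1

lemma card_le_choose_edgeSpan {K : Finset (Sym2 V)} {T : Finset V} (h : K ⊆ completeEdges T) :
    K.card ≤ (edgeSpan K).card.choose 2 := by
  rw [← card_completeEdges]
  refine card_le_card fun e he => ?_
  induction e with
  | h x y =>
    have h1 := mk_mem_completeEdges.1 (h he)
    exact mk_mem_completeEdges.2 ⟨mem_filter.2 ⟨mem_univ _, _, he, Sym2.mem_mk_left x y⟩,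
      mem_filter.2 ⟨mem_univ _, _, he, Sym2.mem_mk_right x y⟩, h1.2.2⟩

lemma card_filter_subset_le (k : ℕ) (U : Finset V) :
    ((univ.powersetCard k).filter fun T => U ⊆ T).card ≤ Fintype.card V ^ (k - U.card) := by
  have h : ((univ.powersetCard k).filter fun T => U ⊆ T).card ≤
      ((univ : Finset V).powersetCard (k - U.card)).card := by
    refine card_le_card_of_injOn (fun T => T \ U) (fun T hT => ?_) fun T hT T' hT' h => ?_
    · obtain ⟨h1, h2⟩ := mem_filter.1 (mem_coe.1 hT)
      refine mem_coe.2 (mem_powersetCard.2 ⟨subset_univ _, ?_⟩)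
      rw [card_sdiff_of_subset h2, (mem_powersetCard.1 h1).2]
    · rw [← sdiff_union_of_subset (mem_filter.1 (mem_coe.1 hT)).2,
        ← sdiff_union_of_subset (mem_filter.1 (mem_coe.1 hT')).2]
      exact congrArg (· ∪ U) h
  refine h.trans ?_
  rw [card_powersetCard, card_univ]
  exact Nat.choose_le_pow _ _

/-- A family of vertex sets of size `r + 1` whose complete graphs are covered by a light family
of sets of at least two edges is small. -/
lemma card_le_of_cover {r : ℕ} {p : ℝ} (hp : 0 < p) (hp1 : p ≤ 1)
    (hV : 1 ≤ Fintype.card V)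
    (hpV : 1 ≤ p ^ (r + 2) * √(Fintype.card V)) (cover : Finset (Finset (Sym2 V)))
    (hcard : ∀ K ∈ cover, 2 ≤ K.card) (F : Finset (Finset V)) (hF : ∀ T ∈ F, T.card = r + 1)
    (hcov : ∀ T ∈ F, ∃ K ∈ cover, K ⊆ completeEdges T) :
    p * √(Fintype.card V) * F.card ≤
      (∑ K ∈ cover, p ^ K.card) * (Fintype.card V : ℝ) ^ (r - 1) := by
  set n := Fintype.card V
  set z : ℝ := √n with hz
  have hz1 : 1 ≤ z := Real.one_le_sqrt.2 (by exact_mod_cast hV)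
  have hzn : z ^ 2 = n := Real.sq_sqrt (by positivity)
  have h1 : F.card ≤ ∑ K ∈ cover, (F.filter fun T => K ⊆ completeEdges T).card := by
    refine (card_le_card fun T hT => ?_).trans card_biUnion_le
    obtain ⟨K, hK, hKT⟩ := hcov T hT
    exact mem_biUnion.2 ⟨K, hK, mem_filter.2 ⟨hT, hKT⟩⟩
  have h2 : ∀ K ∈ cover, p * z * ((F.filter fun T => K ⊆ completeEdges T).card : ℝ) ≤
      p ^ K.card * (n : ℝ) ^ (r - 1) := fun K hK => by
    rcases (F.filter fun T => K ⊆ completeEdges T).eq_empty_or_nonempty with h0 | ⟨T, hT⟩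
    · rw [h0]; simp; positivity
    obtain ⟨hTF, hKT⟩ := mem_filter.1 hT
    have hl := card_le_choose_edgeSpan hKT
    have hlr : (edgeSpan K).card ≤ r + 1 := hF T hTF ▸ card_le_card (edgeSpan_subset hKT)
    have hK2 := hcard K hK
    have hcount : (F.filter fun T => K ⊆ completeEdges T).card ≤
        n ^ (r + 1 - (edgeSpan K).card) := by
      refine (card_le_card fun T' hT' => ?_).trans (card_filter_subset_le (r + 1) (edgeSpan K))
      obtain ⟨h3, h4⟩ := mem_filter.1 hT'
      exact mem_filter.2 ⟨mem_powersetCard.2 ⟨subset_univ _, hF T' h3⟩, edgeSpan_subset h4⟩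
    generalize (edgeSpan K).card = l at hl hlr hcount
    have hl3 : 3 ≤ l := by
      by_contra! hlt
      have : l.choose 2 ≤ Nat.choose 2 2 := Nat.choose_le_choose 2 (by omega)
      simp at this
      omega
    obtain ⟨m, rfl⟩ : ∃ m, l = m + 1 + 2 := ⟨l - 3, by omega⟩
    -- A bound linear in `m + 1 = l - 2`, valid as `m + 2 ≤ r`: each spanned vertex beyond the
    -- second then costs a factor `p^(r+2)`, which `√n` compensates by hypothesis.
    have hch : (m + 1 + 2).choose 2 ≤ 1 + (r + 2) * (m + 1) := by
      have h6 : (m + 1 + 2).choose 2 = (m + 3) * (m + 2) / 2 := by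
        rw [Nat.choose_two_right]; rfl
      rw [h6]
      refine Nat.div_le_of_le_mul ?_
      have : m + 2 ≤ r := by omega
      nlinarith
    have hpow : p * (p ^ (r + 2)) ^ (m + 1) ≤ p ^ K.card := by
      rw [← pow_mul, ← pow_succ']
      exact pow_le_pow_of_le_one hp.le hp1 (by omega)
    have hr : r - 1 = (r + 1 - (m + 1 + 2)) + (m + 1) := by omega
    calc p * z * ((F.filter fun T => K ⊆ completeEdges T).card : ℝ)
        ≤ p * z ^ (m + 1) * (n : ℝ) ^ (r + 1 - (m + 1 + 2)) := by
          gcongr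
          · exact le_self_pow₀ hz1 (by omega)
          · exact_mod_cast hcount
      _ ≤ p * ((p ^ (r + 2) * z) ^ (m + 1) * z ^ (m + 1)) * (n : ℝ) ^ (r + 1 - (m + 1 + 2)) := by
          gcongr
          exact le_mul_of_one_le_left (by positivity) (one_le_pow₀ hpV)
      _ = p * (p ^ (r + 2)) ^ (m + 1) * (n : ℝ) ^ (r - 1) := by
          rw [hr, pow_add _ _ (m + 1), ← hzn, mul_pow]
          ring
      _ ≤ _ := by gcongr
  calc p * z * (F.card : ℝ)
      ≤ p * z * ((∑ K ∈ cover, (F.filter fun T => K ⊆ completeEdges T).card : ℕ) : ℝ) := by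
        gcongr
    _ = ∑ K ∈ cover, p * z * ((F.filter fun T => K ⊆ completeEdges T).card : ℝ) := by
        push_cast; rw [mul_sum]
    _ ≤ ∑ K ∈ cover, p ^ K.card * (n : ℝ) ^ (r - 1) := sum_le_sum h2
    _ = _ := by rw [sum_mul]

/-- The monochromatic edges of `G` under the colouring `c`. -/
def monoGraph {C : Type*} (G : SimpleGraph V) (c : V → C) : SimpleGraph V where
  Adj x y := G.Adj x y ∧ c x = c y
  symm := ⟨fun _ _ h => ⟨h.1.symm, h.2.symm⟩⟩
  loopless := ⟨fun _ h => G.irrefl h.1⟩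

instance {C : Type*} [DecidableEq C] (G : SimpleGraph V) [DecidableRel G.Adj] (c : V → C) :
    DecidableRel (G.monoGraph c).Adj :=
  fun x y => inferInstanceAs (Decidable (G.Adj x y ∧ c x = c y))

omit [DecidableEq V] in
lemma adjPairs_univ (G : SimpleGraph V) [DecidableRel G.Adj] :
    G.adjPairs univ univ = 2 * G.edgeFinset.card := by
  rw [adjPairs_eq_sum_card]
  have := G.sum_degrees_eq_twice_card_edges
  simp only [← card_neighborFinset_eq_degree, neighborFinset_eq_filter] at this
  exact_mod_cast this

omit [DecidableEq V] in
lemma monoPairs_univ {C : Type*} [DecidableEq C] (G : SimpleGraph V) [DecidableRel G.Adj]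
    (c : V → C) : G.monoPairs univ c = 2 * (G.monoGraph c).edgeFinset.card := by
  rw [← adjPairs_univ, monoPairs, adjPairs]
  refine sum_congr rfl fun x _ => sum_congr rfl fun y _ => ?_
  by_cases h1 : c x = c y <;> by_cases h2 : G.Adj x y <;> simp [monoGraph, h1, h2]

/-- A graph far from partite stays so, in terms of monochromatic pairs, when it is enlarged and a
few edges are removed. -/
lemma FarFromPartite.le_monoPairs {G H : SimpleGraph V} [DecidableRel H.Adj] {r : ℕ} {t : ℝ}
    (hG : G.FarFromPartite r t) {S : Finset (Sym2 V)}
    (hGH : ∀ x y, G.Adj x y → s(x, y) ∈ S ∨ H.Adj x y) (c : V → Fin r) :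
    2 * (t - S.card) ≤ H.monoPairs univ c := by
  classical
  rw [monoPairs_univ]
  -- The bichromatic part of `G` is `r`-colourable, so more than `t` edges are monochromatic, and
  -- those outside `S` lie in `H`.
  set G' : SimpleGraph V :=
    { Adj := fun x y => G.Adj x y ∧ c x ≠ c y
      symm := ⟨fun _ _ h => ⟨h.1.symm, h.2.symm⟩⟩
      loopless := ⟨fun _ h => G.irrefl h.1⟩ } with hG'
  have hfar : (G'.edgeFinset.card : ℝ) < G.edgeFinset.card - t := by
    by_contra! hle
    refine hG ⟨G', fun x y h => h.1, ⟨Coloring.mk c fun h => h.2⟩, ?_⟩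
    rw [Set.ncard_eq_toFinset_card', Set.ncard_eq_toFinset_card']
    exact hle
  have hsub : G.edgeFinset ⊆ G'.edgeFinset ∪ (S ∪ (H.monoGraph c).edgeFinset) := fun e he => by
    induction e with
    | h x y =>
      have hadj : G.Adj x y := by simpa using he
      by_cases hc : c x = c y
      · rcases hGH x y hadj with h | h
        · exact mem_union_right _ (mem_union_left _ h)
        · refine mem_union_right _ (mem_union_right _ ?_)
          rw [mem_edgeFinset, mem_edgeSet]
          exact ⟨h, hc⟩
      · refine mem_union_left _ ?_
        rw [mem_edgeFinset, mem_edgeSet]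
        exact ⟨hadj, hc⟩
  have h1 := (card_le_card hsub).trans ((card_union_le _ _).trans
    (Nat.add_le_add_left (card_union_le _ _) _))
  have h2 : (G.edgeFinset.card : ℝ) ≤
      G'.edgeFinset.card + (S.card + (H.monoGraph c).edgeFinset.card) := by exact_mod_cast h1
  linarith

lemma card_filter_card_le {W : Type*} [Fintype W] [DecidableEq W] (k : ℕ) :
    ((univ : Finset (Finset W)).filter fun S => S.card ≤ k).card ≤ (Fintype.card W + 1) ^ k := by
  have h1 : ((univ : Finset (Finset W)).filter fun S => S.card ≤ k) ⊆
      (range (k + 1)).biUnion fun i => univ.powersetCard i := fun S hS => by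
    have := (mem_filter.1 hS).2
    simp; omega
  refine (card_le_card h1).trans (card_biUnion_le.trans ?_)
  rw [add_pow]
  refine sum_le_sum fun i hi => ?_
  rw [card_powersetCard, card_univ, one_pow, mul_one]
  have : 0 < k.choose i := Nat.choose_pos (by simp at hi; omega)
  exact (Nat.choose_le_pow _ _).trans (Nat.le_mul_of_pos_right _ this)

/-- In the Turán graph, uneven parts cost at most `m/2` with `m = n % r`, and the natural-number
division at most `1`; together at most `r`. -/
lemma le_extremalNumber {n r : ℕ} (hr : 2 ≤ r) :
    (1 - 1 / r) * (n : ℝ) ^ 2 / 2 - r ≤ extremalNumber n (⊤ : SimpleGraph (Fin (r + 1))) := by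
  have h1 : (turanGraph n r).edgeFinset.card ≤
      extremalNumber n (⊤ : SimpleGraph (Fin (r + 1))) := by
    have h := card_edgeFinset_le_extremalNumber (G := turanGraph n r)
      (H := (⊤ : SimpleGraph (Fin (r + 1)))) (by
        have := turanGraph_cliqueFree (n := n) (r := r) (by omega)
        rw [← Fintype.card_fin (r + 1), cliqueFree_iff_top_free] at this
        exact this)
    simpa using h
  refine le_trans ?_ (Nat.cast_le.2 h1)
  rw [card_edgeFinset_turanGraph]
  set m := n % r with hm
  have hmr : m < r := Nat.mod_lt _ (by omega)
  have hmn : m ≤ n := Nat.mod_le _ _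
  have h2 : (n ^ 2 - m ^ 2) * (r - 1) < 2 * r * ((n ^ 2 - m ^ 2) * (r - 1) / (2 * r) + 1) :=
    Nat.lt_mul_div_succ _ (by omega)
  have h2' : (((n ^ 2 - m ^ 2) * (r - 1) : ℕ) : ℝ) <
      2 * r * (((n ^ 2 - m ^ 2) * (r - 1) / (2 * r) : ℕ) + 1) := by exact_mod_cast h2
  rw [Nat.cast_mul, Nat.cast_sub (Nat.pow_le_pow_left hmn 2), Nat.cast_sub (by omega)] at h2'
  set D : ℝ := (((n ^ 2 - m ^ 2) * (r - 1) / (2 * r) : ℕ) : ℝ)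
  push_cast [Nat.cast_choose_two] at h2' ⊢
  have hr0 : (2 : ℝ) ≤ r := by exact_mod_cast hr
  have hm0 : (m : ℝ) + 1 ≤ r := by exact_mod_cast hmr
  have hm1 : (0 : ℝ) ≤ m := by positivity
  have h3 : (1 - 1 / r) * (n : ℝ) ^ 2 / 2 - (1 - 1 / r) * (m : ℝ) ^ 2 / 2 ≤ D + 1 := by
    have : (1 - 1 / r) * (n : ℝ) ^ 2 / 2 - (1 - 1 / r) * (m : ℝ) ^ 2 / 2 =
        ((n : ℝ) ^ 2 - m ^ 2) * (r - 1) / (2 * r) := by field_simp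
    rw [this, div_le_iff₀ (by positivity)]
    linarith
  have h4 : (1 - 1 / r) * (m : ℝ) ^ 2 / 2 ≤ (m : ℝ) ^ 2 / 2 := by
    have : (0 : ℝ) ≤ 1 / r * (m : ℝ) ^ 2 := by positivity
    linarith
  nlinarith

end SimpleGraph

/-! ### Counting far graphs through containers -/

namespace SimpleGraph

open Finset

/-- A graph far from `r`-partite up to a few edges whose `(r + 1)`-cliques have a light cover has
noticeably fewer edges than the Turán bound. -/
lemma card_edgeFinset_le_of_cover {n r : ℕ} {p t : ℝ} (hn : 1 ≤ n) (hr : 2 ≤ r) (hp : 0 < p)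
    (hp1 : p ≤ 1) (hpn : 1 ≤ p ^ (r + 2) * √n)
    (herr : 8 ^ r * (r + 1).factorial * ((r + 1).choose 2 : ℝ) ^ 2 * (n : ℝ) ^ 2 ≤ t / 4 * √n)
    {G H : SimpleGraph (Fin n)} [DecidableRel H.Adj] (hG : G.FarFromPartite r t)
    {S : Finset (Sym2 (Fin n))} (hS : (S.card : ℝ) ≤ t / 8)
    (hGH : ∀ x y, G.Adj x y → s(x, y) ∈ S ∨ H.Adj x y)
    (cover : Finset (Finset (Sym2 (Fin n)))) (hcard : ∀ K ∈ cover, 2 ≤ K.card)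
    (hcov : ∀ T ∈ H.cliquesIn (r + 1) univ, ∃ K ∈ cover, K ⊆ completeEdges T)
    (hsum : ∑ K ∈ cover, p ^ K.card ≤ 4 * ((r + 1).choose 2 : ℝ) ^ 2 * p * n ^ 2) :
    (H.edgeFinset.card : ℝ) ≤ (1 - 1 / r) * (n : ℝ) ^ 2 / 2 - 3 * t / 4 := by
  obtain ⟨k, rfl⟩ : ∃ k, r = k + 1 := ⟨r - 1, by omega⟩
  have hn0 : (0 : ℝ) < n := by exact_mod_cast hn
  have hz : 0 < √(n : ℝ) := Real.sqrt_pos.2 hn0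
  set z := √(n : ℝ)
  set X : ℝ := ((k + 1 + 1).choose 2 : ℝ) ^ 2 with hX
  set f : ℝ := ((k + 1 + 1).factorial : ℝ) with hf
  have hf0 : 0 < f := by rw [hf]; positivity
  have h1 := card_le_of_cover (V := Fin n) hp hp1 (by simpa using hn) (by simpa using hpn) cover
    hcard (H.cliquesIn (k + 1 + 1) univ) (fun T hT => (H.mem_cliquesIn.1 hT).1.2)
    hcov
  rw [Fintype.card_fin, Nat.add_sub_cancel] at h1
  have h2 : z * (H.cliquesIn (k + 1 + 1) univ).card ≤ 4 * X * n ^ 2 * (n : ℝ) ^ k := by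
    have h3 : p * (z * (H.cliquesIn (k + 1 + 1) univ).card) ≤
        p * (4 * X * n ^ 2 * (n : ℝ) ^ k) := by
      calc _ = p * z * (H.cliquesIn (k + 1 + 1) univ).card := by ring
        _ ≤ _ := h1
        _ ≤ 4 * X * p * n ^ 2 * (n : ℝ) ^ k := by gcongr
        _ = _ := by ring
    exact le_of_mul_le_mul_left h3 hp
  have h3 := H.le_orderedCliques k univ (2 * (t - S.card)) fun c => hG.le_monoPairs hGH c
  rw [adjPairs_univ, card_univ, Fintype.card_fin] at h3
  have h4 := H.orderedCliques_le (k + 1 + 1) univ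
  set B : ℝ := 2 * (H.edgeFinset.card : ℝ) + 2 * (t - S.card) - (1 - 1 / (k + 1)) * (n : ℝ) ^ 2
    with hB
  have h5 : z * B ≤ 8 ^ (k + 1) * f * X * n ^ 2 := by
    have h6 : 1 / 2 * (1 / 8) ^ k * (n : ℝ) ^ k * (z * B) ≤
        1 / 2 * (1 / 8) ^ k * (n : ℝ) ^ k * (8 ^ (k + 1) * f * X * n ^ 2) := by
      calc 1 / 2 * (1 / 8) ^ k * (n : ℝ) ^ k * (z * B)
          = z * (1 / 2 * (1 / 8) ^ k * (n : ℝ) ^ k * B) := by ring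
        _ ≤ z * (f * (H.cliquesIn (k + 1 + 1) univ).card) := by
            exact mul_le_mul_of_nonneg_left (h3.trans h4) hz.le
        _ = f * (z * (H.cliquesIn (k + 1 + 1) univ).card) := by ring
        _ ≤ f * (4 * X * n ^ 2 * (n : ℝ) ^ k) := by gcongr
        _ = _ := by
            have : (1 / 8 : ℝ) ^ k * 8 ^ k = 1 := by rw [← mul_pow]; norm_num
            rw [pow_succ (8 : ℝ)]
            linear_combination (-4 * f * X * n ^ 2 * (n : ℝ) ^ k) * this
    exact le_of_mul_le_mul_left h6 (by positivity)
  -- Halving `B`, the edge deficit of `H` is at least `t - |S| - t/8 ≥ 3t/4`.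
  have h6 : B ≤ t / 4 := by
    have : z * B ≤ z * (t / 4) := (h5.trans herr).trans (le_of_eq (mul_comm _ _))
    exact le_of_mul_le_mul_left this hz
  push_cast
  linarith

/-- The bound for the number of clique-free graphs that are far from partite, with explicit
conditions on the parameters. -/
theorem ncard_cliqueFreeFarFamily_le {n r : ℕ} {p t : ℝ} (hn : 1 ≤ n) (hr : 2 ≤ r) (hp : 0 < p)
    (hp1 : p ≤ 1) (hpn : 1 ≤ p ^ (r + 2) * √n)
    (hlog : 32 * ((r + 1).choose 2 : ℝ) ^ 5 * p * (n : ℝ) ^ 2 * Real.logb 2 (2 * n ^ 2) ≤ t / 8)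
    (herr : 8 ^ r * (r + 1).factorial * ((r + 1).choose 2 : ℝ) ^ 2 * (n : ℝ) ^ 2 ≤ t / 4 * √n) :
    ((cliqueFreeFarFamily n r t).ncard : ℝ) ≤
      2 ^ ((1 - 1 / r) * (n : ℝ) ^ 2 / 2 - 5 * t / 8) := by
  classical
  have hn0 : (1 : ℝ) ≤ n := by exact_mod_cast hn
  have : NeZero n := ⟨by omega⟩
  have hs : 1 ≤ (r + 1).choose 2 := Nat.choose_pos (by omega)
  set s := (r + 1).choose 2
  have hN : (Fintype.card (Sym2 (Fin n)) : ℝ) ≤ (n : ℝ) ^ 2 := by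
    have : Fintype.card (Sym2 (Fin n)) ≤ n ^ 2 := by
      rw [Sym2.card, Fintype.card_fin, Nat.choose_two_right]
      refine Nat.div_le_of_le_mul ?_
      simp
      nlinarith
    exact_mod_cast this
  have hlog1 : 1 ≤ Real.logb 2 (2 * n ^ 2) := by
    rw [Real.le_logb_iff_rpow_le (by norm_num) (by positivity), Real.rpow_one]
    nlinarith
  set k := ⌊32 * (s : ℝ) ^ 5 * p * Fintype.card (Sym2 (Fin n))⌋₊ with hk
  have hkn : (k : ℝ) ≤ 32 * (s : ℝ) ^ 5 * p * (n : ℝ) ^ 2 :=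
    (Nat.floor_le (by positivity)).trans (by gcongr)
  have hkt : (k : ℝ) ≤ t / 8 := by
    refine hkn.trans (le_trans ?_ hlog)
    exact le_mul_of_one_le_right (by positivity) hlog1
  obtain ⟨f, cover, hcont⟩ := HypergraphContainer.exists_container
    (fun T : {T : Finset (Fin n) // T.card = r + 1} => completeEdges T.1) hs
    (fun T => by rw [card_completeEdges, T.2]) hp
  have hind : ∀ G : SimpleGraph (Fin n), G.CliqueFree (r + 1) →
      ∀ T : {T : Finset (Fin n) // T.card = r + 1}, ¬ completeEdges T.1 ⊆ G.edgeFinset := by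
    intro G hG T hT
    refine hG T.1 ⟨fun x hx y hy hxy => ?_, T.2⟩
    simpa using hT (mk_mem_completeEdges.2 ⟨hx, hy, hxy⟩)
  have hfp : ∀ G : SimpleGraph (Fin n), ∃ S : Finset (Sym2 (Fin n)), G.CliqueFree (r + 1) →
      S ⊆ G.edgeFinset ∧ S.card ≤ k ∧ G.edgeFinset ⊆ S ∪ f S ∧ (∀ K ∈ cover S, 2 ≤ K.card) ∧
      (∀ T : {T : Finset (Fin n) // T.card = r + 1}, completeEdges T.1 ⊆ f S →
        ∃ K ∈ cover S, K ⊆ completeEdges T.1) ∧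
      ∑ K ∈ cover S, p ^ K.card ≤ 4 * (s : ℝ) ^ 2 * p * n ^ 2 := fun G => by
    by_cases hG : G.CliqueFree (r + 1)
    · obtain ⟨S, h1, h2, h3, h4, h5, h6⟩ := hcont G.edgeFinset (hind G hG)
      exact ⟨S, fun _ => ⟨h1, Nat.le_floor h2, h3, h4, h5, h6.trans (by gcongr)⟩⟩
    · exact ⟨∅, fun h => absurd h hG⟩
  choose S hS using hfp
  set F := (univ : Finset (SimpleGraph (Fin n))).filter
    (fun G => G ∈ cliqueFreeFarFamily n r t) with hF
  have hFcard : (cliqueFreeFarFamily n r t).ncard = F.card := by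
    rw [← Set.ncard_coe_finset]; congr 1; ext G; simp [hF]
  have hfree : ∀ G ∈ F, G.CliqueFree (r + 1) := fun G hG => (mem_filter.1 hG).2.1
  have hfiber : ∀ U : Finset (Sym2 (Fin n)), ((F.filter fun G => S G = U).card : ℝ) ≤
      2 ^ ((1 - 1 / r) * (n : ℝ) ^ 2 / 2 - 3 * t / 4) := fun U => by
    rcases (F.filter fun G => S G = U).eq_empty_or_nonempty with h0 | ⟨G, hG⟩
    · rw [h0]; simp; positivity
    obtain ⟨hGF, rfl⟩ := mem_filter.1 hG
    set U := S G
    obtain ⟨-, hUk, hGU, hcard, hcov, hsum⟩ := hS G (hfree G hGF)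
    -- `f U` may contain loops, as `Sym2` does; they are discarded here.
    set H := fromEdgeSet (f U : Set (Sym2 (Fin n))) with hH
    have hedge : ∀ G' ∈ F.filter fun G => S G = U, G'.edgeFinset ∩ f U ⊆ H.edgeFinset := by
      intro G' _ e he
      obtain ⟨h1, h2⟩ := mem_inter.1 he
      rw [mem_edgeFinset, hH, edgeSet_fromEdgeSet]
      exact ⟨h2, G'.not_isDiag_of_mem_edgeSet (mem_edgeFinset.1 h1)⟩
    have hle : (F.filter fun G => S G = U).card ≤ 2 ^ H.edgeFinset.card := by
      rw [← card_powerset]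
      refine card_le_card_of_injOn (fun G' => G'.edgeFinset ∩ f U)
        (fun G' hG' => mem_coe.2 (mem_powerset.2 (hedge G' hG'))) fun G₁ h₁ G₂ h₂ h => ?_
      -- Since `U ⊆ G' ⊆ U ∪ f U`, the trace on `f U` determines `G'`.
      have hrec : ∀ G' ∈ F.filter fun G => S G = U,
          G'.edgeFinset = U ∪ G'.edgeFinset ∩ f U := fun G' hG' => by
        obtain ⟨h1, h2⟩ := mem_filter.1 hG'
        obtain ⟨h3, -, h4, -⟩ := hS G' (hfree G' h1)
        rw [h2] at h3 h4
        refine Subset.antisymm (fun e he => ?_) (union_subset h3 inter_subset_left)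
        rcases mem_union.1 (h4 he) with h5 | h5
        · exact mem_union_left _ h5
        · exact mem_union_right _ (mem_inter.2 ⟨he, h5⟩)
      rw [← edgeFinset_inj, hrec G₁ h₁, hrec G₂ h₂]
      exact congrArg (U ∪ ·) h
    have hHe := card_edgeFinset_le_of_cover (H := H) hn hr hp hp1 hpn herr
      (mem_filter.1 hGF).2.2 (S := U) (le_trans (by exact_mod_cast hUk) hkt)
      (fun x y hxy => by
        rcases mem_union.1 (hGU (mem_edgeFinset.2 ((mem_edgeSet G).2 hxy))) with h1 | h1
        · exact Or.inl h1
        · exact Or.inr ((fromEdgeSet_adj _).2 ⟨h1, hxy.ne⟩))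
      (cover U) hcard (fun T hT => by
        obtain ⟨⟨-, h1⟩, h2⟩ := H.mem_cliquesIn.1 hT
        refine hcov ⟨T, h1⟩ fun e he => ?_
        induction e with
        | h x y =>
          obtain ⟨hx, hy, hxy⟩ := mk_mem_completeEdges.1 he
          exact ((fromEdgeSet_adj _).1 (h2 x hx y hy hxy)).1) hsum
    calc ((F.filter fun G => S G = U).card : ℝ) ≤ ((2 ^ H.edgeFinset.card : ℕ) : ℝ) := by
          exact_mod_cast hle
      _ = (2 : ℝ) ^ (H.edgeFinset.card : ℝ) := by rw [Real.rpow_natCast]; push_cast; rfl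
      _ ≤ _ := Real.rpow_le_rpow_of_exponent_le (by norm_num) (by convert hHe)
  set P := (univ : Finset (Finset (Sym2 (Fin n)))).filter fun U => U.card ≤ k with hP
  have hPcard : (P.card : ℝ) ≤ 2 ^ (t / 8) := by
    have h1 : (P.card : ℝ) ≤ (2 * (n : ℝ) ^ 2) ^ k := by
      calc (P.card : ℝ) ≤ ((Fintype.card (Sym2 (Fin n)) : ℝ) + 1) ^ k := by
            exact_mod_cast card_filter_card_le k
        _ ≤ (2 * (n : ℝ) ^ 2) ^ k := by
            gcongr
            nlinarith
    refine h1.trans ?_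
    have h2 : (2 * (n : ℝ) ^ 2) = 2 ^ Real.logb 2 (2 * n ^ 2) :=
      (Real.rpow_logb (by norm_num) (by norm_num) (by positivity)).symm
    rw [h2, ← Real.rpow_mul_natCast (by norm_num)]
    refine Real.rpow_le_rpow_of_exponent_le (by norm_num) (le_trans ?_ hlog)
    rw [mul_comm]
    exact mul_le_mul_of_nonneg_right hkn (by linarith)
  have hmaps : ∀ G ∈ F, S G ∈ P := fun G hG =>
    mem_filter.2 ⟨mem_univ _, (hS G (hfree G hG)).2.1⟩
  rw [hFcard, card_eq_sum_card_fiberwise hmaps]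
  push_cast
  calc ∑ U ∈ P, ((F.filter fun G => S G = U).card : ℝ)
      ≤ P.card • (2 : ℝ) ^ ((1 - 1 / r) * (n : ℝ) ^ 2 / 2 - 3 * t / 4) :=
        sum_le_card_nsmul _ _ _ fun U _ => hfiber U
    _ ≤ 2 ^ (t / 8) * (2 : ℝ) ^ ((1 - 1 / r) * (n : ℝ) ^ 2 / 2 - 3 * t / 4) := by
        rw [nsmul_eq_mul]; gcongr
    _ = _ := by rw [← Real.rpow_add (by norm_num)]; congr 1; ring

end SimpleGraph

/-! ### Choice of parameters -/

open Filter in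
lemma eventually_log_large (c : ℝ) :
    ∀ᶠ n : ℕ in atTop, c ≤ Real.log n ∧ 172 * Real.log (Real.log n) ≤ Real.log n := by
  have h1 : Tendsto (fun n : ℕ => Real.log n) atTop atTop :=
    Real.tendsto_log_atTop.comp tendsto_natCast_atTop_atTop
  have h2 : ∀ᶠ x : ℝ in atTop, 172 * Real.log x ≤ x := by
    filter_upwards [Real.isLittleO_log_id_atTop.bound (show (0 : ℝ) < 1 / 172 by norm_num),
      eventually_ge_atTop 1] with x hx hx1
    rw [Real.norm_of_nonneg (Real.log_nonneg hx1), id, Real.norm_of_nonneg (by linarith)] at hx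
    linarith
  exact (h1.eventually_ge_atTop c).and (h1.eventually h2)

theorem theorem5p1 :
    ∃ N : ℕ, ∀ n : ℕ, N ≤ n → ∀ r : ℕ, 2 ≤ r →
      (r : ℝ) ≤ Real.log (n : ℝ) / (120 * Real.log (Real.log (n : ℝ))) →
      ((cliqueFreeFarFamily n r
          ((8 * Real.log (n : ℝ)) ^ (-13 : ℤ) * (n : ℝ) ^ 2)).ncard : ℝ) ≤
        (2 : ℝ) ^ ((SimpleGraph.extremalNumber n (⊤ : SimpleGraph (Fin (r + 1))) : ℝ)
          - (n : ℝ)) := by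
  -- The threshold makes `192 * 8^13 * t / L ≤ t / 8` below.
  obtain ⟨N, hN⟩ := Filter.eventually_atTop.1 (eventually_log_large (192 * 8 ^ 14))
  refine ⟨max N 2, fun n hn r hr hrn => ?_⟩
  obtain ⟨hL, hLL⟩ := hN n ((le_max_left _ _).trans hn)
  have hn2 : 2 ≤ n := (le_max_right _ _).trans hn
  have hn0 : (2 : ℝ) ≤ n := by exact_mod_cast hn2
  set L := Real.log n with hLdef
  have hL0 : 0 < L := by linarith
  have hL1 : 1 ≤ L := by linarith
  have hll : 1 ≤ Real.log L := by
    rw [Real.le_log_iff_exp_le hL0]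
    linarith [Real.exp_one_lt_d9]
  have hr0 : (2 : ℝ) ≤ r := by exact_mod_cast hr
  have hrL : 120 * (r * Real.log L) ≤ L := by
    rw [le_div_iff₀ (by positivity)] at hrn; linarith
  have hrL' : 120 * (r : ℝ) ≤ L := by nlinarith
  set z := √(n : ℝ) with hz
  have hz1 : 1 ≤ z := Real.one_le_sqrt.2 (by linarith)
  have hzn : z * z = n := Real.mul_self_sqrt (by positivity)
  -- In logarithms: `50(r+2) log L ≤ L`. The part with `r` uses `5L/12`, leaving `100 log L ≤
  -- 7L/12`, which follows from the constant `172 > 1200/7`.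
  have hpow : L ^ (25 * (r + 2)) ≤ z := by
    rw [← Real.log_le_log_iff (by positivity) (by positivity), Real.log_pow, hz,
      Real.log_sqrt (by positivity), ← hLdef]
    push_cast
    nlinarith
  set t : ℝ := (8 * L) ^ (-13 : ℤ) * (n : ℝ) ^ 2 with ht
  have ht' : (8 * L) ^ 13 * t = (n : ℝ) ^ 2 := by
    rw [ht, zpow_neg, ← mul_assoc]
    norm_cast
    rw [mul_inv_cancel₀ (by positivity), one_mul]
  have hs : ((r + 1).choose 2 : ℝ) ≤ L ^ 2 := by
    rw [Nat.cast_choose_two]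
    push_cast
    nlinarith
  have hlogb : Real.logb 2 (2 * (n : ℝ) ^ 2) ≤ 6 * L := by
    have h2 : 1 / 2 ≤ Real.log 2 := by linarith [Real.log_two_gt_d9]
    rw [Real.logb, div_le_iff₀ (by linarith)]
    have : Real.log (2 * (n : ℝ) ^ 2) ≤ 3 * L := by
      have h3 : (2 * (n : ℝ) ^ 2) ≤ (n : ℝ) ^ 3 := by nlinarith [sq_nonneg (n : ℝ)]
      have h4 := Real.log_le_log (by positivity) h3
      rw [Real.log_pow] at h4
      exact_mod_cast h4
    nlinarith
  -- The exponent `25` pays for `s^5 ≤ L^10`, one `L` from `logb`, `L^13` from `t`, and one spare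
  -- `L` to absorb constants.
  have hmain := SimpleGraph.ncard_cliqueFreeFarFamily_le (n := n) (r := r) (p := (L ^ 25)⁻¹)
    (t := t) (by omega) hr (by positivity) (inv_le_one_of_one_le₀ (one_le_pow₀ hL1))
    (by
      rw [inv_pow, ← pow_mul, inv_mul_eq_div, le_div_iff₀ (by positivity), one_mul]
      exact hpow)
    (by
      calc 32 * ((r + 1).choose 2 : ℝ) ^ 5 * (L ^ 25)⁻¹ * (n : ℝ) ^ 2 *
            Real.logb 2 (2 * n ^ 2)
          ≤ 32 * ((r + 1).choose 2 : ℝ) ^ 5 * (L ^ 25)⁻¹ * (n : ℝ) ^ 2 * (6 * L) := by gcongr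
        _ ≤ 32 * (L ^ 2) ^ 5 * (L ^ 25)⁻¹ * (n : ℝ) ^ 2 * (6 * L) := by gcongr
        _ = 192 * 8 ^ 13 * t / L := by
            rw [← ht']; field_simp; ring
        _ ≤ t / 8 := by
            have ht0 : 0 ≤ t := by rw [ht]; positivity
            rw [div_le_iff₀ hL0]
            nlinarith)
    (by
      have hfac : ((r + 1).factorial : ℝ) ≤ L ^ (r + 1) := by
        have h1 : ((r + 1).factorial : ℝ) ≤ ((r + 1 : ℕ) : ℝ) ^ (r + 1) := by
          exact_mod_cast Nat.factorial_le_pow _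
        refine h1.trans (pow_le_pow_left₀ (by positivity) ?_ _)
        push_cast; linarith
      have h8 : (8 : ℝ) ^ r ≤ L ^ r := pow_le_pow_left₀ (by norm_num) (by linarith) r
      have ht0 : 0 ≤ t := by rw [ht]; positivity
      calc 8 ^ r * (r + 1).factorial * ((r + 1).choose 2 : ℝ) ^ 2 * (n : ℝ) ^ 2
          ≤ L ^ r * L ^ (r + 1) * (L ^ 2) ^ 2 * (n : ℝ) ^ 2 := by gcongr
        _ = t / 4 * (L ^ (2 * r + 18) * (4 * 8 ^ 13)) := by rw [← ht']; ring
        _ ≤ t / 4 * (L ^ (2 * r + 18) * L) := by gcongr; linarith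
        _ = t / 4 * L ^ (2 * r + 19) := by ring
        _ ≤ t / 4 * L ^ (25 * (r + 2)) :=
            mul_le_mul_of_nonneg_left (pow_le_pow_right₀ hL1 (by omega)) (by positivity)
        _ ≤ t / 4 * z := by gcongr)
  refine hmain.trans (Real.rpow_le_rpow_of_exponent_le (by norm_num) ?_)
  have hex := SimpleGraph.le_extremalNumber (n := n) hr
  have hrn' : (r : ℝ) ≤ n := by
    have : L ≤ n := (Real.log_le_sub_one_of_pos (by linarith)).trans (by linarith)
    linarith
  -- Then `5t/8 ≥ 2n ≥ n + r`, covering the target's `n` and the loss `r` in the Turán number.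
  have htn : 4 * (n : ℝ) ≤ t := by
    have h1 : 4 * (8 * L) ^ 13 ≤ n := by
      calc 4 * (8 * L) ^ 13 = 4 * 8 ^ 13 * L ^ 13 := by ring
        _ ≤ L * L ^ 13 := by gcongr; linarith
        _ = L ^ 14 := by ring
        _ ≤ L ^ (25 * (r + 2)) := pow_le_pow_right₀ hL1 (by omega)
        _ ≤ z := hpow
        _ ≤ n := by nlinarith
    have h2 : (8 * L) ^ 13 * (4 * n) ≤ (8 * L) ^ 13 * t := by
      rw [ht']; nlinarith
    exact le_of_mul_le_mul_left h2 (by positivity)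
  linarith
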